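/- Work in the untyped $\lambda$-calculus, with terms taken modulo $\alpha$-equivalence. Write $\triangleright$ for one-step $\beta$-reduction, $\triangleright^*$ for its reflexive and transitive closure, and $\Omega=(\lambda x.(x\;x))\,(\lambda x.(x\;x))$. Let $\triangleright_{\beta\Omega}$ be the union of $\triangleright$ and of the rule that replaces an unsolvable sub-term by $\Omega$. Write $u\simeq v$ if $u$ and $v$ have a common $\triangleright_{\beta\Omega}^*$-reduct. For a term $t$ write $t[B]$ for $t[x:=B]$. Let $F$ and $A$ be terms such that $F$ has exactly one free variable $x$, $F$ has no $\beta$-normal form, $x$ occurs in every $t'$ with $F\triangleright_{\beta\Omega}^* t'$, and $F[A]\not\simeq F[\Omega]$. Let $(F_k)_{k\in\mathbb N}$ be a sequence of terms such that $F_0=F$; $F_k\triangleright^*F_{k+1}$ for each $k$, by a fixed $\beta$-reduction sequence $\rho_k$; whenever $F\triangleright^*G$ there is $k$ with $G\triangleright^*F_k$; and $k\mapsto \#(F_k)$ is recursive, where $\#(t)$ is an integer code of $t$. For an occurrence $x_{[j]}$ of $x$ in a term $t$, let $Arg(x_{[j]},t)$ be the maximal list of arguments to which $x_{[j]}$ is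 applied in $t$. An occurrence $x_{[i]}$ of $x$ in $t$ is pure in $t$ if there is no other occurrence $x_{[j]}$ of $x$ in $t$ such that $x_{[i]}$ occurs in an element of the list $Arg(x_{[j]},t)$. It is good in $F_k$ if it is pure in $F_k$ and $u[A]$ is solvable for every sub-term $u$ of $F_k$ in which $x_{[i]}$ occurs. Let $\mathcal T$ be the tree whose level $k$ is the set of pure occurrences of $x$ in $F_k$, where an occurrence at level $k+1$ is a son of an occurrence at level $k$ if it is a residue of it along $\rho_k$. Theorem. There is an infinite branch in $\mathcal T$ that is good: there are occurrences $x_{(k)}$ of $x$ in $F_k$ ($k\in\mathbb N$) such that, for every $k$, $x_{(k)}$ is pure and good in $F_k$, and $x_{(k+1)}$ is a residue of $x_{(k)}$ along $\rho_k$. -/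

import Mathlib

namespace LambdaH

/-- Lambda terms modulo alpha-equivalence (de Bruijn indices). A variable `var n` lying under `d`
abstractions is bound if `n < d`; otherwise it denotes the free variable number `n - d`. -/
inductive Term : Type
  | var : ℕ → Term
  | app : Term → Term → Term
  | lam : Term → Term

namespace Term

/-- Pass a renaming of variables under an abstraction. -/
def upRen (ξ : ℕ → ℕ) : ℕ → ℕ
  | 0 => 0
  | n + 1 => ξ n + 1

def rename : (ℕ → ℕ) → Term → Term
  | ξ, var n => var (ξ n)
  | ξ, app t u => app (rename ξ t) (rename ξ u)
  | ξ, lam t => lam (rename (upRen ξ) t)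

/-- Pass a substitution under an abstraction. -/
def up (σ : ℕ → Term) : ℕ → Term
  | 0 => var 0
  | n + 1 => rename Nat.succ (σ n)

/-- Simultaneous capture-avoiding substitution. -/
def subst : (ℕ → Term) → Term → Term
  | σ, var n => σ n
  | σ, app t u => app (subst σ t) (subst σ u)
  | σ, lam t => lam (subst (up σ) t)

/-- The substitution `[x := A]`; all other variables are left unchanged. -/
def single (x : ℕ) (A : Term) : ℕ → Term :=
  fun n => if n = x then A else var n

/-- The contractum `M[0 := N]` of the redex `(lam M) N`. -/
def inst (M N : Term) : Term :=
  subst (fun n => match n with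
    | 0 => N
    | m + 1 => var m) M

/-- `(t t₁ ... tₙ)`. -/
def apps (t : Term) (args : List Term) : Term :=
  args.foldl app t

def I : Term := lam (var 0)

def delta : Term := lam (app (var 0) (var 0))

def Omega : Term := app delta delta

/-- The variable `x` is free in the term. -/
def FreeIn : ℕ → Term → Prop
  | x, var n => n = x
  | x, app t u => FreeIn x t ∨ FreeIn x u
  | x, lam t => FreeIn (x + 1) t

/-- An integer coding the way a term is built. -/
def code : Term → ℕ
  | var n => Nat.pair 0 n
  | app t u => Nat.pair 1 (Nat.pair (code t) (code u))
  | lam t => Nat.pair 2 (code t)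

end Term

open Term

/-- One step down in a term: to the function part or to the argument part of an application,
or to the body of an abstraction. -/
inductive Dir : Type
  | fn : Dir
  | arg : Dir
  | body : Dir

/-- A position in a term, read from the root. -/
abbrev Pos : Type := List Dir

/-- The number of abstractions crossed by a position. -/
def Pos.depth : Pos → ℕ
  | [] => 0
  | Dir.fn :: p => Pos.depth p
  | Dir.arg :: p => Pos.depth p
  | Dir.body :: p => Pos.depth p + 1

/-- The sub-term at a given position, if the position exists in the term. -/
def subtermAt : Term → Pos → Option Term
  | t, [] => some t
  | app t _, Dir.fn :: p => subtermAt t p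
  | app _ u, Dir.arg :: p => subtermAt u p
  | lam t, Dir.body :: p => subtermAt t p
  | _, _ :: _ => none

/-- `BetaAt p t t'`: the term `t` has a beta-redex at position `p`, and `t'` is the result of
contracting it. -/
inductive BetaAt : Pos → Term → Term → Prop
  | redex (M N : Term) : BetaAt [] (app (lam M) N) (inst M N)
  | fn {p : Pos} {t t' : Term} (u : Term) (h : BetaAt p t t') :
      BetaAt (Dir.fn :: p) (app t u) (app t' u)
  | arg {p : Pos} {u u' : Term} (t : Term) (h : BetaAt p u u') :
      BetaAt (Dir.arg :: p) (app t u) (app t u')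
  | body {p : Pos} {t t' : Term} (h : BetaAt p t t') :
      BetaAt (Dir.body :: p) (lam t) (lam t')

/-- One step of beta-reduction. -/
def Beta (t t' : Term) : Prop := ∃ p, BetaAt p t t'

def BetaStar : Term → Term → Prop := Relation.ReflTransGen Beta

def Normal (t : Term) : Prop := ∀ t', ¬ Beta t t'

def Normalizable (t : Term) : Prop := ∃ t', BetaStar t t' ∧ Normal t'

/-- A term is solvable if some substitution instance of it, applied to some terms, is
beta-equal to the identity, i.e. (the identity being normal) beta-reduces to it. -/
def Solvable (t : Term) : Prop :=
  ∃ (σ : ℕ → Term) (args : List Term), BetaStar (apps (subst σ t) args) I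

/-- One step of beta- or Omega-reduction: somewhere in the term a beta-redex is contracted,
or an unsolvable sub-term is replaced by `Omega`. -/
inductive BetaOmega : Term → Term → Prop
  | beta (M N : Term) : BetaOmega (app (lam M) N) (inst M N)
  | omega {t : Term} (h : ¬ Solvable t) : BetaOmega t Omega
  | fn {t t' : Term} (u : Term) (h : BetaOmega t t') : BetaOmega (app t u) (app t' u)
  | arg {u u' : Term} (t : Term) (h : BetaOmega u u') : BetaOmega (app t u) (app t u')
  | body {t t' : Term} (h : BetaOmega t t') : BetaOmega (lam t) (lam t')

def BetaOmegaStar : Term → Term → Prop := Relation.ReflTransGen BetaOmega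

/-- Equality modulo beta-Omega-reduction: having a common reduct. -/
def EqH (u v : Term) : Prop := ∃ w, BetaOmegaStar u w ∧ BetaOmegaStar v w

/-- `x` occurs free in every beta-Omega-reduct of `t`. -/
def InBetaOmega (x : ℕ) (t : Term) : Prop :=
  ∀ t', BetaOmegaStar t t' → FreeIn x t'

/-- The position `q` is an occurrence of the free variable `x` in `t`. -/
def IsOcc (x : ℕ) (t : Term) (q : Pos) : Prop :=
  subtermAt t q = some (var (x + Pos.depth q))

/-- `a` is the position of one of the elements of the maximal list `V` of arguments of the
occurrence `j`, where `(j V)` is the applicative context of `j`: the occurrence `j` is reached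
from an application node `s`, whose argument is at `a`, by going only to function parts. -/
def IsArgPos (j a : Pos) : Prop :=
  ∃ (s : Pos) (n : ℕ), j = s ++ List.replicate (n + 1) Dir.fn ∧ a = s ++ [Dir.arg]

/-- The occurrence `i` of `x` is pure in `t`: it does not lie in an element of the argument list
of another occurrence `j` of `x` in `t`. -/
def IsPure (x : ℕ) (t : Term) (i : Pos) : Prop :=
  IsOcc x t i ∧ ¬ ∃ j a, j ≠ i ∧ IsOcc x t j ∧ IsArgPos j a ∧ a <+: i

/-- The occurrence `i` of `x` is good in `t` (with respect to `A`): it is pure, and `u[A]` is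
solvable for each sub-term `u` of `t` in which `i` lies. Under `d` abstractions, the substitution
`[x := A]` is `up^[d] (single x A)`. -/
def IsGood (x : ℕ) (A t : Term) (i : Pos) : Prop :=
  IsPure x t i ∧
    ∀ (q : Pos) (u : Term), q <+: i → subtermAt t q = some u →
      Solvable (subst (up^[Pos.depth q] (single x A)) u)

/-- `StepResidue t p q q'`: when the redex of `t` at position `p` is contracted, `q'` is a residue
of the position `q`. Positions outside the redex do not move; those in the body of the
contracted abstraction, other than the variable being replaced, have one residue; those in the
argument have one residue in each copy of the argument. -/
inductive StepResidue (t : Term) (p : Pos) : Pos → Pos → Prop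
  | outside {q : Pos} (h : ¬ p <+: q) : StepResidue t p q q
  | inBody {M N : Term} {r : Pos} (h : subtermAt t p = some (app (lam M) N))
      (hr : subtermAt M r ≠ some (var (Pos.depth r))) :
      StepResidue t p (p ++ Dir.fn :: Dir.body :: r) (p ++ r)
  | inArg {M N : Term} {s r : Pos} (h : subtermAt t p = some (app (lam M) N))
      (hs : subtermAt M s = some (var (Pos.depth s))) :
      StepResidue t p (p ++ Dir.arg :: r) (p ++ s ++ r)

/-- A beta-reduction sequence from `t` to `t'`, given by the redexes contracted successively.
It is data, since residues depend on the reduction and not only on its two ends. -/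
inductive Reduction (t : Term) : Term → Type
  | refl : Reduction t t
  | tail {u v : Term} (ρ : Reduction t u) (p : Pos) (h : BetaAt p u v) : Reduction t v

/-- `ρ.Residue q q'`: the position `q'` is a residue of `q` along the reduction `ρ`. -/
def Reduction.Residue {t : Term} : {t' : Term} → Reduction t t' → Pos → Pos → Prop
  | _, .refl, q, q' => q = q'
  | _, .tail (u := u) ρ p _, q, q' => ∃ r, ρ.Residue q r ∧ StepResidue u p r q'

/-- `b` is an infinite branch of the tree whose level `k` is the set of pure occurrences of `x` in
`Fs k`, the sons of an occurrence at level `k` being its residues along `ρ k` at level `k + 1`. -/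
def IsInfiniteBranch (x : ℕ) (Fs : ℕ → Term) (ρ : ∀ k, Reduction (Fs k) (Fs (k + 1)))
    (b : ℕ → Pos) : Prop :=
  (∀ k, IsPure x (Fs k) (b k)) ∧ ∀ k, (ρ k).Residue (b k) (b (k + 1))

/-- A branch is good if the occurrence that it chooses at each level `k` is good in `Fs k`. -/
def IsGoodBranch (x : ℕ) (A : Term) (Fs : ℕ → Term) (b : ℕ → Pos) : Prop :=
  ∀ k, IsGood x A (Fs k) (b k)

end LambdaH

/-!
The proof applies König's lemma to the tree of good occurrences. Each `Fs k` has finitely many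
occurrences of `x`, so it is enough that every level has a good occurrence and that every good
occurrence at level `k + 1` is a residue of a good occurrence at level `k`.

*Good occurrences exist* (`exists_isGood`). Suppose that `t`, a reduct of `F`, has no good
occurrence. Each pure occurrence of `x` then lies in a sub-term `u` with `u[A]` unsolvable, and hence
so does every occurrence, because each impure one lies in an argument of a pure one and
applying an unsolvable term leaves it unsolvable. Replacing the maximal such `u` by `Omega` gives a
common reduct of `t[A]` and `t[Omega]`, so `F[A]` and `F[Omega]` would be equal modulo
beta-Omega-reduction (`eqH_of_forall_inUnsolvable`). This uses that `u[Omega]` is unsolvable when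
`u[A]` is, the genericity of `Omega`. It holds by simulation: `Omega` reduces only to itself and
is not an abstraction, so a reduction of `C[Omega]` to the identity can be followed in `C[A]`, and
the identity contains no `Omega` (`OmegaLe.simulate`, `Solvable.of_omegaLe`).

*Goodness passes to ancestors* (`BetaAt.exists_ancestor`, `Reduction.exists_good_ancestor`). In a
beta-step each sub-term containing an occurrence of `x` becomes, around its residue, a reduct, an
instance or a renaming of itself, or, for the function part of the redex, its
application is contracted; in all these cases solvability goes back to the original sub-term.
Moreover, if an occurrence lies in an argument of another occurrence of `x`, then so do its residues,
since `x` is never replaced and its application is never a redex. So purity also passes to ancestors.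
-/

namespace LambdaH

open Term

/-! ### Substitution -/

namespace Term

theorem upRen_comp (ξ ζ : ℕ → ℕ) : upRen ζ ∘ upRen ξ = upRen (ζ ∘ ξ) := by
  funext n; cases n <;> rfl

theorem rename_rename (t : Term) (ξ ζ : ℕ → ℕ) :
    rename ζ (rename ξ t) = rename (ζ ∘ ξ) t := by
  induction t generalizing ξ ζ with
  | var n => rfl
  | app t u iht ihu => simp only [rename, iht, ihu]
  | lam t ih => simp only [rename, ih, upRen_comp]

theorem up_comp_upRen (ξ : ℕ → ℕ) (σ : ℕ → Term) : up σ ∘ upRen ξ = up (σ ∘ ξ) := by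
  funext n; cases n <;> rfl

theorem subst_rename (t : Term) (ξ : ℕ → ℕ) (σ : ℕ → Term) :
    subst σ (rename ξ t) = subst (σ ∘ ξ) t := by
  induction t generalizing ξ σ with
  | var n => rfl
  | app t u iht ihu => simp only [rename, subst, iht, ihu]
  | lam t ih => simp only [rename, subst, ih, up_comp_upRen]

theorem rename_up (ξ : ℕ → ℕ) (σ : ℕ → Term) :
    rename (upRen ξ) ∘ up σ = up (rename ξ ∘ σ) := by
  funext n
  cases n with
  | zero => rfl
  | succ n =>
    simp only [Function.comp, up, rename_rename]
    rfl

theorem rename_subst (t : Term) (ξ : ℕ → ℕ) (σ : ℕ → Term) :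
    rename ξ (subst σ t) = subst (rename ξ ∘ σ) t := by
  induction t generalizing ξ σ with
  | var n => rfl
  | app t u iht ihu => simp only [rename, subst, iht, ihu]
  | lam t ih => simp only [rename, subst, ih, rename_up]

theorem subst_up_comp_up (σ τ : ℕ → Term) :
    subst (up τ) ∘ up σ = up (subst τ ∘ σ) := by
  funext n
  cases n with
  | zero => rfl
  | succ n =>
    simp only [Function.comp, up, subst_rename, rename_subst]
    rfl

theorem subst_subst (t : Term) (σ τ : ℕ → Term) :
    subst τ (subst σ t) = subst (subst τ ∘ σ) t := by
  induction t generalizing σ τ with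
  | var n => rfl
  | app t u iht ihu => simp only [subst, iht, ihu]
  | lam t ih => simp only [subst, ih, subst_up_comp_up]

theorem up_var : up var = var := by
  funext n; cases n <;> rfl

theorem subst_var (t : Term) : subst var t = t := by
  induction t with
  | var n => rfl
  | app t u iht ihu => simp only [subst, iht, ihu]
  | lam t ih => simp only [subst, up_var, ih]

theorem rename_eq_subst (ξ : ℕ → ℕ) (t : Term) : rename ξ t = subst (var ∘ ξ) t := by
  have h := rename_subst t ξ var
  rw [subst_var] at h
  exact h

/-- The substitution performed by a beta-step: `inst M N = subst (instSub N) M`. -/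
def instSub (N : Term) : ℕ → Term
  | 0 => N
  | n + 1 => var n

theorem inst_eq (M N : Term) : inst M N = subst (instSub N) M := by
  unfold inst
  congr 1

theorem subst_comp_instSub (N : Term) (σ : ℕ → Term) :
    subst σ ∘ instSub N = subst (instSub (subst σ N)) ∘ up σ := by
  funext n
  cases n with
  | zero => rfl
  | succ n =>
    simp only [Function.comp, up, subst_rename]
    exact (subst_var _).symm

theorem subst_inst (M N : Term) (σ : ℕ → Term) :
    subst σ (inst M N) = inst (subst (up σ) M) (subst σ N) := by
  rw [inst_eq, inst_eq, subst_subst, subst_subst, subst_comp_instSub]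

theorem subst_iterate_up_comp (d : ℕ) (σ τ : ℕ → Term) :
    subst (up^[d] τ) ∘ up^[d] σ = up^[d] (subst τ ∘ σ) := by
  induction d generalizing σ τ with
  | zero => rfl
  | succ d ih => simp only [Function.iterate_succ, Function.comp_apply, ih, subst_up_comp_up]

theorem iterate_up_lt {d n : ℕ} (h : n < d) (σ : ℕ → Term) : (up^[d] σ) n = var n := by
  induction d generalizing n with
  | zero => omega
  | succ d ih =>
    rw [Function.iterate_succ_apply']
    cases n with
    | zero => rfl
    | succ n => simp only [up, ih (Nat.lt_of_succ_lt_succ h)]; rfl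

theorem iterate_up_add (d n : ℕ) (σ : ℕ → Term) :
    (up^[d] σ) (n + d) = rename (· + d) (σ n) := by
  induction d with
  | zero => simp only [Function.iterate_zero, id, Nat.add_zero, rename_eq_subst]
            exact (subst_var _).symm
  | succ d ih =>
    rw [Function.iterate_succ_apply']
    change rename Nat.succ ((up^[d] σ) (n + d)) = _
    rw [ih, rename_rename]; rfl

theorem iterate_up_comp_iterate_upRen (e : ℕ) (ξ : ℕ → ℕ) (σ : ℕ → Term) :
    up^[e] σ ∘ upRen^[e] ξ = up^[e] (σ ∘ ξ) := by
  induction e generalizing ξ σ with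
  | zero => rfl
  | succ e ih => simp only [Function.iterate_succ, Function.comp_apply, ih, up_comp_upRen]

theorem rename_comp_iterate_up (e : ℕ) (ξ : ℕ → ℕ) (σ : ℕ → Term) :
    rename (upRen^[e] ξ) ∘ up^[e] σ = up^[e] (rename ξ ∘ σ) := by
  induction e generalizing ξ σ with
  | zero => rfl
  | succ e ih => simp only [Function.iterate_succ, Function.comp_apply, ih, rename_up]

theorem iterate_upRen_lt {e n : ℕ} (h : n < e) (ξ : ℕ → ℕ) : upRen^[e] ξ n = n := by
  induction e generalizing n with
  | zero => omega
  | succ e ih =>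
    rw [Function.iterate_succ_apply']
    cases n with
    | zero => rfl
    | succ n => exact congrArg (· + 1) (ih (Nat.lt_of_succ_lt_succ h))

theorem iterate_upRen_add (e d n : ℕ) : upRen^[e] (· + d) (n + e) = n + e + d := by
  induction e with
  | zero => rfl
  | succ e ih =>
    rw [Function.iterate_succ_apply']
    change upRen^[e] (· + d) (n + e) + 1 = _
    rw [ih]; omega

/-- A term lying under `e` binders of its own inside an argument, copied below `d` further binders:
the ambient substitution `σ` commutes with the copying. -/
theorem subst_rename_shift (t : Term) (e d : ℕ) (σ : ℕ → Term) :
    subst (up^[d + e] σ) (rename (upRen^[e] (· + d)) t) =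
      rename (upRen^[e] (· + d)) (subst (up^[e] σ) t) := by
  rw [subst_rename, rename_subst, rename_comp_iterate_up, Nat.add_comm d e,
    Function.iterate_add_apply, iterate_up_comp_iterate_upRen]
  congr 2
  funext n
  exact iterate_up_add d n σ

end Term

/-! ### Reduction and solvability -/

theorem BetaAt.subst {p : Pos} {t t' : Term} (h : BetaAt p t t') (σ : ℕ → Term) :
    BetaAt p (Term.subst σ t) (Term.subst σ t') := by
  induction h generalizing σ with
  | redex M N => rw [subst_inst]; exact .redex _ _
  | fn u _ ih => exact .fn _ (ih σ)
  | arg t _ ih => exact .arg _ (ih σ)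
  | body _ ih => exact .body (ih _)

theorem BetaAt.betaOmega {p : Pos} {t t' : Term} (h : BetaAt p t t') : BetaOmega t t' := by
  induction h with
  | redex M N => exact .beta M N
  | fn u _ ih => exact .fn u ih
  | arg t _ ih => exact .arg t ih
  | body _ ih => exact .body ih

theorem Beta.apps {t t' : Term} (h : Beta t t') (args : List Term) :
    Beta (Term.apps t args) (Term.apps t' args) := by
  induction args generalizing t t' with
  | nil => exact h
  | cons a l ih => exact ih (h.elim fun p hp => ⟨_, .fn a hp⟩)

theorem Solvable.of_beta {t t' : Term} (h : Beta t t') (hs : Solvable t') : Solvable t := by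
  obtain ⟨σ, args, hr⟩ := hs
  obtain ⟨p, hp⟩ := h
  exact ⟨σ, args, .head (Beta.apps ⟨p, hp.subst σ⟩ args) hr⟩

theorem Solvable.of_app {t u : Term} (hs : Solvable (app t u)) : Solvable t := by
  obtain ⟨σ, args, hr⟩ := hs
  exact ⟨σ, subst σ u :: args, hr⟩

theorem Solvable.of_subst {t : Term} {τ : ℕ → Term} (hs : Solvable (subst τ t)) :
    Solvable t := by
  obtain ⟨σ, args, hr⟩ := hs
  rw [subst_subst] at hr
  exact ⟨_, args, hr⟩

theorem Solvable.of_rename {t : Term} {ξ : ℕ → ℕ} (hs : Solvable (rename ξ t)) :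
    Solvable t := by
  rw [rename_eq_subst] at hs
  exact hs.of_subst

/-- `OmegaLe s s'`: the term `s'` is obtained from `s` by replacing some sub-terms `Omega` by
arbitrary terms. Since `Omega` is closed, no capture has to be taken into account. -/
inductive OmegaLe : Term → Term → Prop
  | omega (t : Term) : OmegaLe Omega t
  | var (n : ℕ) : OmegaLe (var n) (var n)
  | app {t t' u u' : Term} (ht : OmegaLe t t') (hu : OmegaLe u u') :
      OmegaLe (app t u) (app t' u')
  | lam {t t' : Term} (ht : OmegaLe t t') : OmegaLe (lam t) (lam t')

namespace OmegaLe

theorem rfl' (t : Term) : OmegaLe t t := by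
  induction t with
  | var n => exact .var n
  | app t u iht ihu => exact .app iht ihu
  | lam t ih => exact .lam ih

theorem rename {s s' : Term} (h : OmegaLe s s') (ξ : ℕ → ℕ) :
    OmegaLe (Term.rename ξ s) (Term.rename ξ s') := by
  induction h generalizing ξ with
  | omega t => exact .omega _
  | var n => exact .var _
  | app _ _ iht ihu => exact .app (iht ξ) (ihu ξ)
  | lam _ ih => exact .lam (ih _)

theorem up {σ σ' : ℕ → Term} (h : ∀ n, OmegaLe (σ n) (σ' n)) (n : ℕ) :
    OmegaLe (Term.up σ n) (Term.up σ' n) := by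
  cases n with
  | zero => exact .var 0
  | succ n => exact (h n).rename _

theorem iterate_up {σ σ' : ℕ → Term} (h : ∀ n, OmegaLe (σ n) (σ' n)) (d n : ℕ) :
    OmegaLe ((Term.up^[d] σ) n) ((Term.up^[d] σ') n) := by
  induction d generalizing σ σ' with
  | zero => exact h n
  | succ d ih => exact ih (up h)

theorem subst {s s' : Term} (h : OmegaLe s s') {σ σ' : ℕ → Term}
    (hσ : ∀ n, OmegaLe (σ n) (σ' n)) : OmegaLe (Term.subst σ s) (Term.subst σ' s') := by
  induction h generalizing σ σ' with
  | omega t => exact .omega _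
  | var n => exact hσ n
  | app _ _ iht ihu => exact .app (iht hσ) (ihu hσ)
  | lam _ ih => exact .lam (ih (up hσ))

theorem apps {s s' : Term} (h : OmegaLe s s') (args : List Term) :
    OmegaLe (Term.apps s args) (Term.apps s' args) := by
  induction args generalizing s s' with
  | nil => exact h
  | cons a l ih => exact ih (.app h (rfl' a))

end OmegaLe

theorem BetaAt.eq_omega {p : Pos} {t : Term} (h : BetaAt p Omega t) : t = Omega := by
  unfold Omega at h
  cases h with
  | redex M N => rfl
  | fn u h => cases h with | body h => cases h with
    | fn _ h => cases h
    | arg _ h => cases h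
  | arg u h => cases h with | body h => cases h with
    | fn _ h => cases h
    | arg _ h => cases h

/-- `OmegaLe` is a simulation: a redex of `s` is either `Omega` itself, which reduces to itself only,
or has an abstraction as function part, and then `s'` has the corresponding redex. -/
theorem OmegaLe.simulate {p : Pos} {s s₁ s' : Term} (hb : BetaAt p s s₁) (h : OmegaLe s s') :
    ∃ s₁', BetaStar s' s₁' ∧ OmegaLe s₁ s₁' := by
  suffices H : OmegaLe s₁ s' ∨ ∃ s₁', BetaAt p s' s₁' ∧ OmegaLe s₁ s₁' by
    rcases H with H | ⟨w, hw, H⟩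
    · exact ⟨s', .refl, H⟩
    · exact ⟨w, .single ⟨p, hw⟩, H⟩
  induction h generalizing p s₁ with
  | omega t => exact .inl (hb.eq_omega ▸ .omega t)
  | var n => cases hb
  | @app t t' u u' ht hu iht ihu =>
    cases hb with
    | redex M N =>
      cases ht with
      | lam hM =>
        refine .inr ⟨_, .redex _ _, ?_⟩
        rw [inst_eq, inst_eq]
        refine hM.subst fun n => ?_
        cases n with
        | zero => exact hu
        | succ n => exact .var n
    | fn _ hb =>
      rcases iht hb with H | ⟨w, hw, H⟩
      · exact .inl (.app H hu)
      · exact .inr ⟨_, .fn _ hw, .app H hu⟩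
    | arg _ hb =>
      rcases ihu hb with H | ⟨w, hw, H⟩
      · exact .inl (.app ht H)
      · exact .inr ⟨_, .arg _ hw, .app ht H⟩
  | lam ht ih =>
    cases hb with
    | body hb =>
      rcases ih hb with H | ⟨w, hw, H⟩
      · exact .inl (.lam H)
      · exact .inr ⟨_, .body hw, .lam H⟩

theorem OmegaLe.simulate_star {s s₁ s' : Term} (hb : BetaStar s s₁) (h : OmegaLe s s') :
    ∃ s₁', BetaStar s' s₁' ∧ OmegaLe s₁ s₁' := by
  induction hb with
  | refl => exact ⟨s', .refl, h⟩
  | tail _ hs ih =>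
    obtain ⟨w, hw, h'⟩ := ih
    obtain ⟨p, hp⟩ := hs
    obtain ⟨w', hw', h''⟩ := OmegaLe.simulate hp h'
    exact ⟨w', hw.trans hw', h''⟩

theorem OmegaLe.eq_I {s : Term} (h : OmegaLe I s) : s = I := by
  cases h with | lam h => cases h; rfl

/-- Genericity of `Omega`. -/
theorem Solvable.of_omegaLe {s s' : Term} (h : OmegaLe s s') (hs : Solvable s) :
    Solvable s' := by
  obtain ⟨σ, args, hr⟩ := hs
  obtain ⟨w, hw, hI⟩ :=
    OmegaLe.simulate_star hr ((h.subst fun n => OmegaLe.rfl' (σ n)).apps args)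
  exact ⟨σ, args, hI.eq_I ▸ hw⟩

theorem omegaLe_subst_single (x d : ℕ) (A t : Term) :
    OmegaLe (subst (up^[d] (single x Omega)) t) (subst (up^[d] (single x A)) t) := by
  refine (OmegaLe.rfl' t).subst (OmegaLe.iterate_up (fun n => ?_) d)
  unfold single
  split
  · exact .omega A
  · exact .var n

/-! ### Congruence of equality modulo beta-Omega-reduction -/

theorem EqH.refl (t : Term) : EqH t t := ⟨t, .refl, .refl⟩

theorem EqH.app {t t' u u' : Term} (ht : EqH t t') (hu : EqH u u') :
    EqH (app t u) (app t' u') := by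
  obtain ⟨w, h₁, h₂⟩ := ht
  obtain ⟨v, h₃, h₄⟩ := hu
  exact ⟨.app w v,
    (h₁.lift (Term.app · u) fun _ _ h => .fn u h).trans
      (h₃.lift (Term.app w) fun _ _ h => .arg w h),
    (h₂.lift (Term.app · u') fun _ _ h => .fn u' h).trans
      (h₄.lift (Term.app w) fun _ _ h => .arg w h)⟩

theorem EqH.lam {t t' : Term} (ht : EqH t t') : EqH (lam t) (lam t') := by
  obtain ⟨w, h₁, h₂⟩ := ht
  exact ⟨.lam w, h₁.lift Term.lam fun _ _ h => .body h, h₂.lift Term.lam fun _ _ h => .body h⟩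

/-! ### Occurrences -/

theorem Pos.depth_append (p q : Pos) : Pos.depth (p ++ q) = Pos.depth p + Pos.depth q := by
  induction p with
  | nil => simp [Pos.depth]
  | cons D p ih => cases D <;> simp [Pos.depth, ih] <;> omega

theorem subtermAt_nil (t : Term) : subtermAt t [] = some t := by
  cases t <;> rfl

theorem subtermAt_append {t u : Term} {p : Pos} (h : subtermAt t p = some u) (q : Pos) :
    subtermAt t (p ++ q) = subtermAt u q := by
  induction p generalizing t with
  | nil => rw [subtermAt_nil] at h; cases h; rfl
  | cons D p ih =>
    cases t <;> cases D <;> first | exact ih h | cases h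

theorem subtermAt_append_none {t : Term} {p : Pos} (h : subtermAt t p = none) (q : Pos) :
    subtermAt t (p ++ q) = none := by
  induction p generalizing t with
  | nil => rw [subtermAt_nil] at h; cases h
  | cons D p ih =>
    cases t <;> cases D <;> first | exact ih h | simp [subtermAt]

theorem subtermAt_var_eq_some {n : ℕ} {q : Pos} {u : Term} (h : subtermAt (var n) q = some u) :
    q = [] ∧ u = var n := by
  cases q with
  | nil => exact ⟨rfl, by simpa [subtermAt] using h.symm⟩
  | cons D q => simp [subtermAt] at h

theorem isOcc_body {x : ℕ} {t : Term} {q : Pos} :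
    IsOcc x (lam t) (Dir.body :: q) ↔ IsOcc (x + 1) t q := by
  unfold IsOcc
  simp only [subtermAt, Pos.depth]
  rw [show x + (Pos.depth q + 1) = x + 1 + Pos.depth q by omega]

theorem finite_setOf_isOcc (x : ℕ) (t : Term) : {q | IsOcc x t q}.Finite := by
  suffices H : {q | subtermAt t q ≠ none}.Finite from
    H.subset fun q (hq : subtermAt t q = _) h => by rw [h] at hq; cases hq
  induction t with
  | var n =>
    refine (Set.finite_singleton []).subset fun q hq => ?_
    cases q with
    | nil => rfl
    | cons D q => exact absurd (by simp [subtermAt]) hq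
  | app t u iht ihu =>
    refine ((Set.finite_singleton []).union
      ((iht.image (Dir.fn :: ·)).union (ihu.image (Dir.arg :: ·)))).subset fun q hq => ?_
    match q, hq with
    | [], _ => exact .inl rfl
    | Dir.fn :: q, hq => exact .inr (.inl ⟨q, hq, rfl⟩)
    | Dir.arg :: q, hq => exact .inr (.inr ⟨q, hq, rfl⟩)
    | Dir.body :: q, hq => exact absurd rfl hq
  | lam t ih =>
    refine ((Set.finite_singleton []).union (ih.image (Dir.body :: ·))).subset fun q hq => ?_
    match q, hq with
    | [], _ => exact .inl rfl
    | Dir.fn :: q, hq => exact absurd rfl hq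
    | Dir.arg :: q, hq => exact absurd rfl hq
    | Dir.body :: q, hq => exact .inr ⟨q, hq, rfl⟩

theorem subtermAt_subst {t u : Term} {q : Pos} (h : subtermAt t q = some u) (σ : ℕ → Term) :
    subtermAt (subst σ t) q = some (subst (up^[Pos.depth q] σ) u) := by
  induction q generalizing t σ with
  | nil => rw [subtermAt_nil] at h ⊢; cases h; rfl
  | cons D q ih =>
    cases t <;> cases D <;> first | exact ih h _ | cases h

theorem subtermAt_rename {t u : Term} {q : Pos} (h : subtermAt t q = some u) (ξ : ℕ → ℕ) :
    subtermAt (rename ξ t) q = some (rename (upRen^[Pos.depth q] ξ) u) := by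
  induction q generalizing t ξ with
  | nil => rw [subtermAt_nil] at h ⊢; cases h; rfl
  | cons D q ih =>
    cases t <;> cases D <;> first | exact ih h _ | cases h

theorem subtermAt_of_rename {t : Term} {q : Pos} {ξ : ℕ → ℕ} {y : ℕ}
    (h : subtermAt (rename ξ t) q = some (var y)) :
    ∃ m, subtermAt t q = some (var m) ∧ upRen^[Pos.depth q] ξ m = y := by
  induction q generalizing t ξ with
  | nil =>
    cases t with
    | var n => exact ⟨n, rfl, by simpa [subtermAt, rename, Pos.depth] using h⟩
    | app t u => simp [subtermAt, rename] at h
    | lam t => simp [subtermAt, rename] at h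
  | cons D q ih =>
    cases t <;> cases D <;> first | exact ih h | cases h

/-- A variable occurrence in `subst σ t` lies in the image of a variable occurrence of `t`. -/
theorem subtermAt_of_subst {t : Term} {q : Pos} {σ : ℕ → Term} {y : ℕ}
    (h : subtermAt (subst σ t) q = some (var y)) :
    ∃ s r m, q = s ++ r ∧ subtermAt t s = some (var m) ∧
      subtermAt ((up^[Pos.depth s] σ) m) r = some (var y) := by
  induction t generalizing q σ with
  | var n => exact ⟨[], q, n, rfl, rfl, h⟩
  | app t u iht ihu =>
    match q, h with
    | [], h => simp [subtermAt, subst] at h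
    | Dir.fn :: q, h =>
      obtain ⟨s, r, m, rfl, hs, hr⟩ := iht h
      exact ⟨Dir.fn :: s, r, m, rfl, hs, hr⟩
    | Dir.arg :: q, h =>
      obtain ⟨s, r, m, rfl, hs, hr⟩ := ihu h
      exact ⟨Dir.arg :: s, r, m, rfl, hs, hr⟩
    | Dir.body :: q, h => cases h
  | lam t ih =>
    match q, h with
    | [], h => simp [subtermAt, subst] at h
    | Dir.fn :: q, h => cases h
    | Dir.arg :: q, h => cases h
    | Dir.body :: q, h =>
      obtain ⟨s, r, m, rfl, hs, hr⟩ := ih h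
      exact ⟨Dir.body :: s, r, m, rfl, hs, hr⟩

theorem subtermAt_inst_body {M N u : Term} {q : Pos} (h : subtermAt M q = some u) :
    subtermAt (inst M N) q = some (subst (up^[Pos.depth q] (instSub N)) u) := by
  rw [inst_eq]
  exact subtermAt_subst h _

theorem subtermAt_inst_arg {M N u : Term} {s q : Pos}
    (hs : subtermAt M s = some (var (Pos.depth s))) (h : subtermAt N q = some u) :
    subtermAt (inst M N) (s ++ q) =
      some (rename (upRen^[Pos.depth q] (· + Pos.depth s)) u) := by
  have h₁ := subtermAt_inst_body (N := N) hs
  have h₂ := iterate_up_add (Pos.depth s) 0 (instSub N)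
  rw [Nat.zero_add] at h₂
  rw [subtermAt_append h₁, subst, h₂]
  exact subtermAt_rename h _

theorem IsOcc.inst_body {x : ℕ} {M N : Term} {q : Pos} (h : IsOcc (x + 1) M q) :
    IsOcc x (inst M N) q := by
  have h₁ := subtermAt_inst_body (N := N) h
  rw [subst, iterate_up_add] at h₁
  exact h₁

theorem IsOcc.inst_arg {x : ℕ} {M N : Term} {s q : Pos}
    (hs : subtermAt M s = some (var (Pos.depth s))) (h : IsOcc x N q) :
    IsOcc x (inst M N) (s ++ q) := by
  have h₁ := subtermAt_inst_arg hs h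
  rw [rename, iterate_upRen_add] at h₁
  rw [IsOcc, h₁, Pos.depth_append]
  congr 2
  omega

/-- A free occurrence of `x` in the contractum of `(lam M) N` comes from `M` or from one of the
copies of `N`. -/
theorem IsOcc.of_inst {x : ℕ} {M N : Term} {q : Pos} (h : IsOcc x (inst M N) q) :
    IsOcc (x + 1) M q ∨
      ∃ s r, q = s ++ r ∧ subtermAt M s = some (var (Pos.depth s)) ∧ IsOcc x N r := by
  rw [IsOcc, inst_eq] at h
  obtain ⟨s, r, m, rfl, hs, hr⟩ := subtermAt_of_subst h
  rw [Pos.depth_append] at hr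
  rcases lt_or_ge m (Pos.depth s) with hm | hm
  · rw [iterate_up_lt hm] at hr
    obtain ⟨rfl, hr⟩ := subtermAt_var_eq_some hr
    injection hr with hr
    simp only [Pos.depth] at hr
    omega
  · obtain ⟨n, rfl⟩ := Nat.exists_eq_add_of_le' hm
    rw [iterate_up_add] at hr
    cases n with
    | zero =>
      right
      refine ⟨s, r, rfl, by rwa [Nat.zero_add] at hs, ?_⟩
      obtain ⟨m, hm, he⟩ := subtermAt_of_rename hr
      rw [IsOcc]
      change subtermAt N r = some (var m) at hm
      rw [hm]
      rcases lt_or_ge m (Pos.depth r) with hlt | hge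
      · rw [iterate_upRen_lt hlt] at he
        omega
      · obtain ⟨n, rfl⟩ := Nat.exists_eq_add_of_le' hge
        rw [iterate_upRen_add] at he
        congr 2
        omega
    | succ n =>
      left
      obtain ⟨rfl, hr⟩ := subtermAt_var_eq_some hr
      injection hr with hr
      simp only [Pos.depth] at hr
      rw [List.append_nil, IsOcc, hs]
      congr 2
      omega

theorem isArgPos_iff {j a : Pos} :
    IsArgPos j a ↔ (∃ n, j = List.replicate (n + 1) Dir.fn ∧ a = [Dir.arg]) ∨
      ∃ D j₁ a₁, j = D :: j₁ ∧ a = D :: a₁ ∧ IsArgPos j₁ a₁ := by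
  constructor
  · rintro ⟨s, n, rfl, rfl⟩
    cases s with
    | nil => exact .inl ⟨n, rfl, rfl⟩
    | cons D s => exact .inr ⟨D, _, _, rfl, rfl, s, n, rfl, rfl⟩
  · rintro (⟨n, rfl, rfl⟩ | ⟨D, _, _, rfl, rfl, s, n, rfl, rfl⟩)
    · exact ⟨[], n, rfl, rfl⟩
    · exact ⟨D :: s, n, rfl, rfl⟩

theorem IsArgPos.cons {j a : Pos} (h : IsArgPos j a) (D : Dir) : IsArgPos (D :: j) (D :: a) :=
  isArgPos_iff.2 (.inr ⟨D, j, a, rfl, rfl, h⟩)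

theorem IsArgPos.append {j a : Pos} (h : IsArgPos j a) (s : Pos) :
    IsArgPos (s ++ j) (s ++ a) := by
  induction s with
  | nil => exact h
  | cons D s ih => exact ih.cons D

/-- An occurrence does not lie in its own arguments. -/
theorem IsArgPos.not_prefix {j a : Pos} (h : IsArgPos j a) : ¬ a <+: j := by
  rintro ⟨w, hw⟩
  obtain ⟨s, n, rfl, rfl⟩ := h
  simp [List.replicate_succ] at hw

theorem isPure_iff {x : ℕ} {t : Term} {i : Pos} :
    IsPure x t i ↔ IsOcc x t i ∧ ∀ j a, IsOcc x t j → IsArgPos j a → ¬ a <+: i := by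
  constructor
  · rintro ⟨h, hn⟩
    refine ⟨h, fun j a hj ha hi => hn ⟨j, a, ?_, hj, ha, hi⟩⟩
    rintro rfl
    exact ha.not_prefix hi
  · rintro ⟨h, hn⟩
    exact ⟨h, fun ⟨j, a, _, hj, ha, hi⟩ => hn j a hj ha hi⟩

/-! ### Ancestors of good occurrences -/

/-- What makes purity and goodness pass from the occurrence `i'` of `x` in `t'` back to the
occurrence `i` in `t`: a sub-term of `t` containing `i` is solvable, under any substitution, as
soon as some sub-term of `t'` containing `i'` is; and if `i` lies in an argument of an occurrence
of `x`, so does `i'`. -/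
structure Reflects (x : ℕ) (t t' : Term) (i i' : Pos) : Prop where
  solvable : ∀ q u, q <+: i → subtermAt t q = some u →
    ∃ q' u', q' <+: i' ∧ subtermAt t' q' = some u' ∧
      ∀ σ, Solvable (subst (up^[Pos.depth q'] σ) u') → Solvable (subst (up^[Pos.depth q] σ) u)
  inArg : ∀ j a, IsOcc x t j → IsArgPos j a → a <+: i →
    ∃ j' a', IsOcc x t' j' ∧ IsArgPos j' a' ∧ a' <+: i'

theorem Reflects.isGood {x : ℕ} {A t t' : Term} {i i' : Pos} (h : Reflects x t t' i i')
    (hi : IsOcc x t i) (hg : IsGood x A t' i') : IsGood x A t i := by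
  refine ⟨isPure_iff.2 ⟨hi, fun j a hj ha hai => ?_⟩, fun q u hq hu => ?_⟩
  · obtain ⟨j', a', hj', ha', hai'⟩ := h.inArg j a hj ha hai
    exact (isPure_iff.1 hg.1).2 j' a' hj' ha' hai'
  · obtain ⟨q', u', hq', hu', hs⟩ := h.solvable q u hq hu
    exact hs _ (hg.2 q' u' hq' hu')

/-- The sub-term condition of `Reflects` at the root is automatic along a beta-step. -/
theorem BetaAt.solvable_root {p : Pos} {t t' u : Term} (hb : BetaAt p t t') (i' : Pos)
    (hu : subtermAt t [] = some u) :
    ∃ q' u', q' <+: i' ∧ subtermAt t' q' = some u' ∧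
      ∀ σ, Solvable (Term.subst (up^[Pos.depth q'] σ) u') →
        Solvable (Term.subst (up^[Pos.depth []] σ) u) := by
  rw [subtermAt_nil] at hu
  cases hu
  exact ⟨[], t', List.nil_prefix, subtermAt_nil t', fun σ => Solvable.of_beta ⟨p, hb.subst σ⟩⟩

/-- An occurrence of a free variable in head position is not affected by a beta-step. -/
theorem BetaAt.isOcc_head {p : Pos} {t t' : Term} (hb : BetaAt p t t') {x n : ℕ}
    (h : IsOcc x t (List.replicate n Dir.fn)) : IsOcc x t' (List.replicate n Dir.fn) := by
  induction hb generalizing n with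
  | redex M N =>
    match n, h with
    | 0, h => simp [IsOcc, subtermAt] at h
    | 1, h => simp [IsOcc, subtermAt] at h
    | n + 2, h => simp [IsOcc, subtermAt, List.replicate_succ] at h
  | fn u _ ih =>
    cases n with
    | zero => simp [IsOcc, subtermAt] at h
    | succ n => exact ih (n := n) h
  | arg t _ ih =>
    cases n with
    | zero => simp [IsOcc, subtermAt] at h
    | succ n => exact h
  | body _ ih =>
    cases n with
    | zero => simp [IsOcc, subtermAt] at h
    | succ n => simp [IsOcc, subtermAt, List.replicate_succ] at h

theorem StepResidue.lift {t t' : Term} {p q q' : Pos} {D : Dir}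
    (ht : ∀ r, subtermAt t' (D :: r) = subtermAt t r) (h : StepResidue t p q q') :
    StepResidue t' (D :: p) (D :: q) (D :: q') := by
  cases h with
  | outside h => exact .outside fun h' => h (List.cons_prefix_cons.1 h').2
  | inBody h hr => exact .inBody (p := D :: p) ((ht p).trans h) hr
  | inArg h hs => exact .inArg (p := D :: p) ((ht p).trans h) hs

theorem reflects_inst_body {x : ℕ} {M N : Term} {r : Pos} :
    Reflects x (app (lam M) N) (inst M N) (Dir.fn :: Dir.body :: r) r := by
  have hb := BetaAt.redex M N
  constructor
  · intro q u hq hu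
    match q, hq, hu with
    | [], hq, hu => exact hb.solvable_root r hu
    | [D], hq, hu =>
      obtain ⟨rfl, _⟩ := List.cons_prefix_cons.1 hq
      cases hu
      exact ⟨[], inst M N, List.nil_prefix, subtermAt_nil _,
        fun σ h => (Solvable.of_beta ⟨_, hb.subst σ⟩ h).of_app⟩
    | D :: E :: q, hq, hu =>
      obtain ⟨rfl, hq₁⟩ := List.cons_prefix_cons.1 hq
      obtain ⟨rfl, hq₂⟩ := List.cons_prefix_cons.1 hq₁
      refine ⟨q, _, hq₂, subtermAt_inst_body hu, fun σ h => ?_⟩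
      -- substituting `N` and then `σ` is an instance of substituting `σ` alone
      rw [subst_subst, subst_iterate_up_comp, subst_comp_instSub, ← subst_iterate_up_comp,
        ← subst_subst] at h
      exact h.of_subst
  · intro j a hj ha hai
    rcases isArgPos_iff.1 ha with ⟨n, rfl, rfl⟩ | ⟨D, j, a, rfl, rfl, ha₁⟩
    · exact absurd hai (by simp)
    obtain ⟨rfl, hai₁⟩ := List.cons_prefix_cons.1 hai
    rcases isArgPos_iff.1 ha₁ with ⟨n, rfl, rfl⟩ | ⟨D, j, a, rfl, rfl, ha₂⟩
    · exact absurd hai₁ (by simp)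
    obtain ⟨rfl, hai₂⟩ := List.cons_prefix_cons.1 hai₁
    exact ⟨j, a, (isOcc_body.1 hj).inst_body, ha₂, hai₂⟩

theorem reflects_inst_arg {x : ℕ} {M N : Term} {s r : Pos}
    (hs : subtermAt M s = some (var (Pos.depth s))) :
    Reflects x (app (lam M) N) (inst M N) (Dir.arg :: r) (s ++ r) := by
  constructor
  · intro q u hq hu
    match q, hq, hu with
    | [], hq, hu => exact (BetaAt.redex M N).solvable_root _ hu
    | D :: q, hq, hu =>
      obtain ⟨rfl, hq₁⟩ := List.cons_prefix_cons.1 hq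
      refine ⟨s ++ q, _, (List.prefix_append_right_inj s).2 hq₁, subtermAt_inst_arg hs hu,
        fun σ h => ?_⟩
      rw [Pos.depth_append, subst_rename_shift] at h
      exact h.of_rename
  · intro j a hj ha hai
    rcases isArgPos_iff.1 ha with ⟨n, rfl, rfl⟩ | ⟨D, j, a, rfl, rfl, ha₁⟩
    · -- the function part of the redex is an abstraction, so `x` is not at its head
      exfalso
      cases n <;> simp [IsOcc, subtermAt, List.replicate_succ] at hj
    obtain ⟨rfl, hai₁⟩ := List.cons_prefix_cons.1 hai
    exact ⟨s ++ j, s ++ a, IsOcc.inst_arg hs hj, ha₁.append s,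
      (List.prefix_append_right_inj s).2 hai₁⟩

/-- Every occurrence of a free variable in the result of a beta-step is a residue of an occurrence
which it reflects. -/
theorem BetaAt.exists_ancestor {p : Pos} {t t' : Term} (hb : BetaAt p t t') {x : ℕ} {i' : Pos}
    (hi' : IsOcc x t' i') :
    ∃ i, StepResidue t p i i' ∧ IsOcc x t i ∧ Reflects x t t' i i' := by
  induction hb generalizing x i' with
  | redex M N =>
    rcases hi'.of_inst with h | ⟨s, r, rfl, hs, hr⟩
    · -- an occurrence of the free variable `x + 1` of `M` is not one of the bound variable `0`
      refine ⟨_, .inBody (p := []) rfl ?_, isOcc_body.2 h, reflects_inst_body⟩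
      rw [IsOcc] at h
      rw [h]
      intro h'
      injection h' with h'
      injection h' with h'
      omega
    · exact ⟨_, .inArg (p := []) rfl hs, hr, reflects_inst_arg hs⟩
  | @fn p t t' u hb ih =>
    have hroot := BetaAt.fn u hb
    match i', hi' with
    | [], hi' => simp [IsOcc, subtermAt] at hi'
    | Dir.body :: i', hi' => cases hi'
    | Dir.fn :: i', hi' =>
      obtain ⟨i, hres, hi, hr⟩ := ih (i' := i') hi'
      refine ⟨Dir.fn :: i, hres.lift fun _ => rfl, hi, fun q v hq hv => ?_, fun j a hj ha hai => ?_⟩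
      · rcases List.prefix_cons_iff.1 hq with rfl | ⟨q, rfl, hq₁⟩
        · exact hroot.solvable_root _ hv
        · obtain ⟨q', v', hq', hv', h⟩ := hr.solvable q v hq₁ hv
          exact ⟨Dir.fn :: q', v', List.cons_prefix_cons.2 ⟨rfl, hq'⟩, hv', h⟩
      · rcases isArgPos_iff.1 ha with ⟨n, rfl, rfl⟩ | ⟨D, j, a, rfl, rfl, ha₁⟩
        · exact absurd hai (by simp)
        · obtain ⟨rfl, hai₁⟩ := List.cons_prefix_cons.1 hai
          obtain ⟨j', a', hj', ha', hai'⟩ := hr.inArg j a hj ha₁ hai₁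
          exact ⟨Dir.fn :: j', Dir.fn :: a', hj', ha'.cons _,
            List.cons_prefix_cons.2 ⟨rfl, hai'⟩⟩
    | Dir.arg :: i', hi' =>
      refine ⟨Dir.arg :: i', .outside (by simp), hi', fun q v hq hv => ?_, fun j a hj ha hai => ?_⟩
      · rcases List.prefix_cons_iff.1 hq with rfl | ⟨q, rfl, hq'⟩
        · exact hroot.solvable_root _ hv
        · exact ⟨Dir.arg :: q, v, hq, hv, fun _ h => h⟩
      · rcases isArgPos_iff.1 ha with ⟨n, rfl, rfl⟩ | ⟨D, j, a, rfl, rfl, ha'⟩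
        · exact ⟨_, _, hroot.isOcc_head hj, ha, hai⟩
        · obtain ⟨rfl, _⟩ := List.cons_prefix_cons.1 hai
          exact ⟨Dir.arg :: j, Dir.arg :: a, hj, ha, hai⟩
  | @arg p u u' t hb ih =>
    have hroot := BetaAt.arg t hb
    match i', hi' with
    | [], hi' => simp [IsOcc, subtermAt] at hi'
    | Dir.body :: i', hi' => cases hi'
    | Dir.arg :: i', hi' =>
      obtain ⟨i, hres, hi, hr⟩ := ih (i' := i') hi'
      refine ⟨Dir.arg :: i, hres.lift fun _ => rfl, hi, fun q v hq hv => ?_,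
        fun j a hj ha hai => ?_⟩
      · rcases List.prefix_cons_iff.1 hq with rfl | ⟨q, rfl, hq₁⟩
        · exact hroot.solvable_root _ hv
        · obtain ⟨q', v', hq', hv', h⟩ := hr.solvable q v hq₁ hv
          exact ⟨Dir.arg :: q', v', List.cons_prefix_cons.2 ⟨rfl, hq'⟩, hv', h⟩
      · rcases isArgPos_iff.1 ha with ⟨n, rfl, rfl⟩ | ⟨D, j, a, rfl, rfl, ha₁⟩
        · exact ⟨_, _, hroot.isOcc_head hj, ha, by simp⟩
        · obtain ⟨rfl, hai₁⟩ := List.cons_prefix_cons.1 hai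
          obtain ⟨j', a', hj', ha', hai'⟩ := hr.inArg j a hj ha₁ hai₁
          exact ⟨Dir.arg :: j', Dir.arg :: a', hj', ha'.cons _,
            List.cons_prefix_cons.2 ⟨rfl, hai'⟩⟩
    | Dir.fn :: i', hi' =>
      refine ⟨Dir.fn :: i', .outside (by simp), hi', fun q v hq hv => ?_, fun j a hj ha hai => ?_⟩
      · rcases List.prefix_cons_iff.1 hq with rfl | ⟨q, rfl, hq'⟩
        · exact hroot.solvable_root _ hv
        · exact ⟨Dir.fn :: q, v, hq, hv, fun _ h => h⟩
      · rcases isArgPos_iff.1 ha with ⟨n, rfl, rfl⟩ | ⟨D, j, a, rfl, rfl, ha'⟩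
        · exact absurd hai (by simp)
        · obtain ⟨rfl, _⟩ := List.cons_prefix_cons.1 hai
          exact ⟨Dir.fn :: j, Dir.fn :: a, hj, ha, hai⟩
  | @body p t t' hb ih =>
    match i', hi' with
    | [], hi' => simp [IsOcc, subtermAt] at hi'
    | Dir.fn :: i', hi' => cases hi'
    | Dir.arg :: i', hi' => cases hi'
    | Dir.body :: i', hi' =>
      obtain ⟨i, hres, hi, hr⟩ := ih (isOcc_body.1 hi')
      refine ⟨Dir.body :: i, hres.lift fun _ => rfl, isOcc_body.2 hi, fun q v hq hv => ?_,
        fun j a hj ha hai => ?_⟩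
      · rcases List.prefix_cons_iff.1 hq with rfl | ⟨q, rfl, hq₁⟩
        · exact (BetaAt.body hb).solvable_root _ hv
        · obtain ⟨q', v', hq', hv', h⟩ := hr.solvable q v hq₁ hv
          exact ⟨Dir.body :: q', v', List.cons_prefix_cons.2 ⟨rfl, hq'⟩, hv', fun σ => h (up σ)⟩
      · rcases isArgPos_iff.1 ha with ⟨n, rfl, rfl⟩ | ⟨D, j, a, rfl, rfl, ha₁⟩
        · exact absurd hai (by simp)
        · obtain ⟨rfl, hai₁⟩ := List.cons_prefix_cons.1 hai
          obtain ⟨j', a', hj', ha', hai'⟩ := hr.inArg j a (isOcc_body.1 hj) ha₁ hai₁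
          exact ⟨Dir.body :: j', Dir.body :: a', isOcc_body.2 hj', ha'.cons _,
            List.cons_prefix_cons.2 ⟨rfl, hai'⟩⟩

theorem Reduction.exists_good_ancestor {t t' : Term} (ρ : Reduction t t') {x : ℕ} {A : Term}
    {i' : Pos} (hg : IsGood x A t' i') : ∃ i, IsGood x A t i ∧ ρ.Residue i i' := by
  induction ρ generalizing i' with
  | refl => exact ⟨i', hg, rfl⟩
  | tail ρ p h ih =>
    obtain ⟨r, hres, hr, href⟩ := h.exists_ancestor hg.1.1
    obtain ⟨i, hi, hir⟩ := ih (href.isGood hr hg)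
    exact ⟨i, hi, r, hir, hres⟩

theorem Reduction.betaStar {t t' : Term} (ρ : Reduction t t') : BetaStar t t' := by
  induction ρ with
  | refl => exact .refl
  | tail _ p h ih => exact ih.tail ⟨p, h⟩

theorem BetaStar.betaOmegaStar_subst {t t' : Term} (h : BetaStar t t') (σ : ℕ → Term) :
    BetaOmegaStar (subst σ t) (subst σ t') :=
  h.lift (subst σ) fun _ _ ⟨_, hp⟩ => (hp.subst σ).betaOmega

/-! ### Existence of good occurrences -/

/-- The occurrence `i`, lying under `d` abstractions of an outer term, is in a sub-term of `t` that
becomes unsolvable when `A` is substituted for `x`. -/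
def InUnsolvable (x : ℕ) (A t : Term) (d : ℕ) (i : Pos) : Prop :=
  ∃ q u, q <+: i ∧ subtermAt t q = some u ∧
    ¬ Solvable (subst (up^[Pos.depth q + d] (single x A)) u)

theorem eqH_of_not_solvable {x d : ℕ} {A t : Term}
    (hs : ¬ Solvable (subst (up^[d] (single x A)) t)) :
    EqH (subst (up^[d] (single x A)) t) (subst (up^[d] (single x Omega)) t) :=
  ⟨Omega, .single (.omega hs),
    .single (.omega fun h => hs (h.of_omegaLe (omegaLe_subst_single x d A t)))⟩

/-- If the whole of `t` remains solvable, the unsolvable sub-term lies in a child of `t`. -/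
theorem InUnsolvable.of_cons {x : ℕ} {A t t₁ : Term} {d : ℕ} {D : Dir} {i : Pos}
    (h : InUnsolvable x A t d (D :: i)) (hs : Solvable (subst (up^[d] (single x A)) t))
    (ht : ∀ r, subtermAt t (D :: r) = subtermAt t₁ r) {e : ℕ} (he : Pos.depth [D] + d = e) :
    InUnsolvable x A t₁ e i := by
  obtain ⟨q, u, hq, hu, hns⟩ := h
  rcases List.prefix_cons_iff.1 hq with rfl | ⟨q, rfl, hq₁⟩
  · rw [subtermAt_nil] at hu
    cases hu
    rw [Pos.depth, Nat.zero_add] at hns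
    exact absurd hs hns
  · refine ⟨q, u, hq₁, (ht q).symm.trans hu, ?_⟩
    have hq₂ : Pos.depth (D :: q) = Pos.depth [D] + Pos.depth q := Pos.depth_append [D] q
    rwa [hq₂, Nat.add_comm (Pos.depth [D]), Nat.add_assoc, he] at hns

/-- If every occurrence of `x` lies in a sub-term that becomes unsolvable when `A` is substituted
for `x`, then `t[A]` and `t[Omega]` are equal: the maximal sub-terms of this kind
all reduce to `Omega`, in `t[A]` by assumption and in `t[Omega]` by genericity. The number `d` counts
the abstractions already crossed. -/
theorem eqH_of_forall_inUnsolvable (x d : ℕ) (A t : Term)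
    (h : ∀ i, IsOcc (x + d) t i → InUnsolvable x A t d i) :
    EqH (subst (up^[d] (single x A)) t) (subst (up^[d] (single x Omega)) t) := by
  induction t generalizing d with
  | var n =>
    by_cases hn : n = x + d
    · obtain ⟨q, u, hq, hu, hns⟩ := h [] (by subst hn; rfl)
      obtain rfl := List.prefix_nil.1 hq
      cases hu
      rw [Pos.depth, Nat.zero_add] at hns
      exact eqH_of_not_solvable hns
    · rcases lt_or_ge n d with hlt | hge
      · simp only [subst, iterate_up_lt hlt]
        exact .refl _
      · obtain ⟨m, rfl⟩ := Nat.exists_eq_add_of_le' hge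
        have hm : m ≠ x := by omega
        simp only [subst, iterate_up_add, single, if_neg hm]
        exact .refl _
  | app t u iht ihu =>
    by_cases hs : Solvable (subst (up^[d] (single x A)) (app t u))
    swap
    · exact eqH_of_not_solvable hs
    refine .app (iht d fun i hi => ?_) (ihu d fun i hi => ?_)
    · exact (h (Dir.fn :: i) hi).of_cons hs (fun _ => rfl) (Nat.zero_add d)
    · exact (h (Dir.arg :: i) hi).of_cons hs (fun _ => rfl) (Nat.zero_add d)
  | lam t ih =>
    by_cases hs : Solvable (subst (up^[d] (single x A)) (lam t))
    swap
    · exact eqH_of_not_solvable hs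
    have hEq := ih (d + 1) fun i hi =>
      (h (Dir.body :: i) (isOcc_body.2 hi)).of_cons hs (fun _ => rfl) (Nat.add_comm 1 d)
    simp only [Function.iterate_succ_apply'] at hEq
    exact hEq.lam

/-- The function parts of a solvable application are solvable. -/
theorem Solvable.of_spine {n : ℕ} {t u : Term}
    (hu : subtermAt t (List.replicate n Dir.fn) = some u) {σ : ℕ → Term}
    (hs : Solvable (subst σ t)) : Solvable (subst σ u) := by
  induction n generalizing t with
  | zero =>
    rw [List.replicate_zero, subtermAt_nil] at hu
    cases hu
    exact hs
  | succ n ih =>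
    cases t with
    | var m => simp [subtermAt, List.replicate_succ] at hu
    | app t v => exact ih (t := t) hu hs.of_app
    | lam t => simp [subtermAt, List.replicate_succ] at hu

theorem Pos.depth_replicate_fn (n : ℕ) : Pos.depth (List.replicate n Dir.fn) = 0 := by
  induction n with
  | zero => rfl
  | succ n ih => exact ih

/-- When no occurrence of `x` is good, the application of an occurrence of `x` to some
arguments lies in a sub-term that becomes unsolvable. If the occurrence is pure this holds because
unsolvability passes from a term to its applications; otherwise it lies in an argument of
another occurrence, whose application starts strictly higher. The position `s` is that of the
application of the occurrence to its arguments, or of any of its function parts but the last. -/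
theorem inUnsolvable_of_spine {x : ℕ} {A t : Term} (hg : ∀ i, ¬ IsGood x A t i) (s : Pos) (n : ℕ)
    (hj : IsOcc x t (s ++ List.replicate (n + 1) Dir.fn)) : InUnsolvable x A t 0 s := by
  by_cases hp : IsPure x t (s ++ List.replicate (n + 1) Dir.fn)
  · have hng := hg (s ++ List.replicate (n + 1) Dir.fn)
    simp only [IsGood, not_and, not_forall] at hng
    obtain ⟨q, u, hq, hu, hns⟩ := hng hp
    rcases List.prefix_or_prefix_of_prefix hq (List.prefix_append s _) with h | ⟨w, rfl⟩
    · exact ⟨q, u, h, hu, hns⟩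
    · obtain ⟨m, rfl⟩ : ∃ m, w = List.replicate m Dir.fn :=
        ⟨w.length, List.eq_replicate_iff.2 ⟨rfl, fun D hD =>
          List.eq_of_mem_replicate (((List.prefix_append_right_inj s).1 hq).subset hD)⟩⟩
      cases hv : subtermAt t s with
      | none => exact absurd hu (subtermAt_append_none hv _ ▸ nofun)
      | some v =>
        rw [subtermAt_append hv] at hu
        rw [Pos.depth_append, Pos.depth_replicate_fn] at hns
        exact ⟨s, v, List.prefix_rfl, hv, fun h => hns (h.of_spine hu)⟩
  · simp only [isPure_iff, hj, true_and, not_forall, not_not] at hp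
    obtain ⟨j', a', hj', ⟨s', n', rfl, rfl⟩, hai⟩ := hp
    have hpre : s' ++ [Dir.arg] <+: s := by
      rcases List.prefix_or_prefix_of_prefix hai (List.prefix_append s _) with h | ⟨w, hw⟩
      · exact h
      · rw [← hw] at hai
        have hw' := ((List.prefix_append_right_inj s).1 hai).subset
        rcases List.eq_nil_or_concat w with rfl | ⟨w, D, rfl⟩
        · rw [← hw, List.append_nil]
        · -- `s' ++ [arg]` would end inside the spine below `s`, which consists of `fn` only
          rw [List.concat_eq_append, ← List.append_assoc] at hw
          obtain ⟨-, h⟩ := List.append_inj' hw rfl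
          cases h
          exact absurd (List.eq_of_mem_replicate (hw' (a := Dir.arg) (by simp))) nofun
    have hlen : s'.length < s.length := by
      have h := hpre.length_le
      rwa [List.length_append, List.length_singleton] at h
    obtain ⟨q, u, hq, hu, hns⟩ := inUnsolvable_of_spine hg s' n' hj'
    exact ⟨q, u, hq.trans ((List.prefix_append _ _).trans hpre), hu, hns⟩
termination_by s.length

theorem inUnsolvable_of_forall_not_isGood {x : ℕ} {A t : Term} (hg : ∀ i, ¬ IsGood x A t i) {i : Pos}
    (hi : IsOcc x t i) : InUnsolvable x A t 0 i := by
  by_cases hp : IsPure x t i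
  · have hng := hg i
    simp only [IsGood, not_and, not_forall] at hng
    obtain ⟨q, u, hq, hu, hns⟩ := hng hp
    exact ⟨q, u, hq, hu, hns⟩
  · simp only [isPure_iff, hi, true_and, not_forall, not_not] at hp
    obtain ⟨j, a, hj, ⟨s, n, rfl, rfl⟩, hai⟩ := hp
    obtain ⟨q, u, hq, hu, hns⟩ := inUnsolvable_of_spine hg s n hj
    exact ⟨q, u, hq.trans ((List.prefix_append _ _).trans hai), hu, hns⟩

theorem exists_isGood {x : ℕ} {A F t : Term} (hF : BetaStar F t)
    (hFA : ¬ EqH (subst (single x A) F) (subst (single x Omega) F)) : ∃ i, IsGood x A t i := by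
  by_contra! hg
  obtain ⟨w, h₁, h₂⟩ := eqH_of_forall_inUnsolvable x 0 A t
    fun i hi => inUnsolvable_of_forall_not_isGood hg hi
  exact hFA ⟨w, (hF.betaOmegaStar_subst _).trans h₁, (hF.betaOmegaStar_subst _).trans h₂⟩

/-! ### König's lemma -/

/-- A sequence of finite nonempty levels in which every node has a parent has an infinite branch. -/
theorem exists_branch {α : Type*} (G : ℕ → Set α) (R : ℕ → α → α → Prop)
    (hfin : ∀ k, (G k).Finite) (hne : ∀ k, (G k).Nonempty)
    (hpar : ∀ k, ∀ y ∈ G (k + 1), ∃ x ∈ G k, R k x y) :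
    ∃ b : ℕ → α, ∀ k, b k ∈ G k ∧ R k (b k) (b (k + 1)) := by
  -- `D n k` is the set of nodes of level `k` with a descendant `n` levels further
  let D : ℕ → ℕ → Set α := fun n => n.rec (motive := fun _ => ℕ → Set α) G
    fun _ E k => {x | x ∈ G k ∧ ∃ y ∈ E (k + 1), R k x y}
  have hD : ∀ n k, D n k ⊆ G k := by
    intro n k
    cases n with
    | zero => exact subset_rfl
    | succ n => exact fun x hx => hx.1
  have hDne : ∀ n k, (D n k).Nonempty := by
    intro n
    induction n with
    | zero => exact hne
    | succ n ih =>
      intro k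
      obtain ⟨y, hy⟩ := ih (k + 1)
      obtain ⟨x, hx, hxy⟩ := hpar k y (hD n _ hy)
      exact ⟨x, hx, y, hy, hxy⟩
  have hanti : ∀ k, Antitone fun n => D n k := by
    suffices H : ∀ n k, D (n + 1) k ⊆ D n k from fun k => antitone_nat_of_succ_le fun n => H n k
    intro n
    induction n with
    | zero => exact fun k => hD 1 k
    | succ n ih => exact fun k x ⟨hx, y, hy, hxy⟩ => ⟨hx, y, ih _ hy, hxy⟩
  -- finiteness of the levels: a decreasing sequence of nonempty subsets has a common element
  have hcomp : ∀ (k : ℕ) (E : ℕ → Set α), Antitone E → (∀ n, (E n).Nonempty) →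
      (∀ n, E n ⊆ G k) → ∃ y, ∀ n, y ∈ E n := by
    intro k E hE hEne hEG
    by_contra! hcon
    choose N hN using hcon
    obtain ⟨M, hM⟩ := ((hfin k).image N).bddAbove
    obtain ⟨y, hy⟩ := hEne M
    exact hN y (hE (hM ⟨y, hEG M hy, rfl⟩) hy)
  obtain ⟨x₀, hx₀⟩ := hcomp 0 (fun n => D n 0) (hanti 0) (fun n => hDne n 0) fun n => hD n 0
  have hstep : ∀ k (x : {x // ∀ n, x ∈ D n k}), ∃ y : {y // ∀ n, y ∈ D n (k + 1)}, R k x y := by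
    rintro k ⟨x, hx⟩
    obtain ⟨y, hy⟩ := hcomp (k + 1) (fun n => {y | y ∈ D n (k + 1) ∧ R k x y})
      (fun m n hmn y hy => ⟨hanti _ hmn hy.1, hy.2⟩) (fun n => (hx (n + 1)).2)
      fun n y hy => hD n _ hy.1
    exact ⟨⟨y, fun n => (hy n).1⟩, (hy 0).2⟩
  choose next hnext using hstep
  let b : ∀ k, {x // ∀ n, x ∈ D n k} := fun k => k.rec ⟨x₀, hx₀⟩ next
  exact ⟨fun k => (b k).1, fun k => ⟨(b k).2 0, hnext k (b k)⟩⟩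

end LambdaH

theorem mainTheorem2 (x : ℕ) (F A : LambdaH.Term)
    (hF_free : ∀ y, LambdaH.Term.FreeIn y F ↔ y = x)
    (hF_norm : ¬ LambdaH.Normalizable F)
    (hF_x : LambdaH.InBetaOmega x F)
    (hFA : ¬ LambdaH.EqH (LambdaH.Term.subst (LambdaH.Term.single x A) F)
      (LambdaH.Term.subst (LambdaH.Term.single x LambdaH.Term.Omega) F))
    (Fs : ℕ → LambdaH.Term) (hFs_zero : Fs 0 = F)
    (ρ : ∀ k, LambdaH.Reduction (Fs k) (Fs (k + 1)))
    (hFs_cofinal : ∀ G, LambdaH.BetaStar F G → ∃ k, LambdaH.BetaStar G (Fs k))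
    (hFs_rec : Computable fun k => LambdaH.Term.code (Fs k)) :
    ∃ b : ℕ → LambdaH.Pos,
      LambdaH.IsInfiniteBranch x Fs ρ b ∧ LambdaH.IsGoodBranch x A Fs b := by
  have hgood : ∀ k, ∃ i, LambdaH.IsGood x A (Fs k) i := by
    intro k
    refine LambdaH.exists_isGood ?_ hFA
    induction k with
    | zero => exact hFs_zero ▸ .refl
    | succ k ih => exact ih.trans (ρ k).betaStar
  obtain ⟨b, hb⟩ := LambdaH.exists_branch (fun k => {i | LambdaH.IsGood x A (Fs k) i})
    (fun k => (ρ k).Residue)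
    (fun k => (LambdaH.finite_setOf_isOcc x (Fs k)).subset fun i hi => hi.1.1) hgood
    fun k i' hi' => (ρ k).exists_good_ancestor hi'
  exact ⟨b, ⟨fun k => (hb k).1.1, fun k => (hb k).2⟩, fun k => (hb k).1⟩
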